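/- Let $K$ be a field and $1\le n\le 6$. Let $Z(n-1)=\{x_1,\dots,x_{n-1},y_1,\dots,y_{n-1}\}$ and let $\Theta$ be an involution of $Z(n-1)$ without fixed points. Assume that $\Theta$ is - symmetric: for all $i,j$, $\Theta(x_i)=x_j$ if and only if $\Theta(y_i)=y_j$, and $\Theta(x_i)=y_j$ if and only if $\Theta(y_i)=x_j$; - even: $\Theta(x_i)=y_j$ implies that $i-j$ is even, and $\Theta(x_i)=x_j$ implies that $i-j$ is odd; - unmixed: there are no $i<j<k<l$ such that $(i,k)$ and $(j,l)$ are linked, where $(p,q)$ is called linked if $\Theta(x_p)=x_q$ or $\Theta(x_p)=y_q$. Let $S(\Theta)\subseteq K[A_1,\dots,A_n,B_1,\dots,B_n]$ be the subring spanned over $K$ by the monomials $A_1^{u_1}\cdots A_n^{u_n}B_1^{v_1}\cdots B_n^{v_n}$ which satisfy the control equations, for all $1\le i,j\le n-1$: $$u_i+u_{i+1}=v_j+v_{j+1},\quad u_j+u_{j+1}=v_i+v_{i+1}\qquad\text{if }\Theta(x_i)=y_j,$$ $$u_i+u_{i+1}=u_j+u_{j+1},\quad v_j+v_{j+1}=v_i+v_{i+1}\qquad\text{if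 }\Theta(x_i)=x_j.$$ Then $S(\Theta)$ is a complete intersection, that is, there are integers $N,c\ge 0$ and a regular sequence $f_1,\dots,f_c$ in $K[X_1,\dots,X_N]$ such that $S(\Theta)\cong K[X_1,\dots,X_N]/(f_1,\dots,f_c)$ as $K$-algebras. -/

import Mathlib

/-- A symmetric matching `(Z(m), Θ)`. The set `Z(m) = {x_1, …, x_m, y_1, …, y_m}` is modelled by
`Fin m ⊕ Fin m`, where `Sum.inl i` is the point `x_{i+1}` and `Sum.inr i` is the point `y_{i+1}`
(indices start at `0`). The number of `A`-variables (and of `B`-variables) of the matching ring is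
`n = m + 1`. -/
structure SymmetricMatching (m : ℕ) where
  /-- the involution `Θ` -/
  Θ : Fin m ⊕ Fin m → Fin m ⊕ Fin m
  involutive : Function.Involutive Θ
  fixedPointFree : ∀ z, Θ z ≠ z
  symm_xx : ∀ i j, Θ (Sum.inl i) = Sum.inl j ↔ Θ (Sum.inr i) = Sum.inr j
  symm_xy : ∀ i j, Θ (Sum.inl i) = Sum.inr j ↔ Θ (Sum.inr i) = Sum.inl j

namespace SymmetricMatching

variable {m : ℕ}

/-- `i` and `j` are linked if `Θ(x_i) = x_j` or `Θ(x_i) = y_j`. -/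
def Linked (D : SymmetricMatching m) (i j : Fin m) : Prop :=
  D.Θ (Sum.inl i) = Sum.inl j ∨ D.Θ (Sum.inl i) = Sum.inr j

/-- `Θ(x_i) = y_j` forces `i - j` to be even, `Θ(x_i) = x_j` forces `i - j` to be odd. -/
def IsEven (D : SymmetricMatching m) : Prop :=
  ∀ i j : Fin m,
    (D.Θ (Sum.inl i) = Sum.inr j → Even (((i : ℕ) : ℤ) - ((j : ℕ) : ℤ))) ∧
    (D.Θ (Sum.inl i) = Sum.inl j → Odd (((i : ℕ) : ℤ) - ((j : ℕ) : ℤ)))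

/-- There are no linked pairs `(i, k)` and `(j, l)` with `i < j < k < l`. -/
def IsUnmixed (D : SymmetricMatching m) : Prop :=
  ¬ ∃ i j k l : Fin m, D.Linked i k ∧ D.Linked j l ∧ i < j ∧ j < k ∧ k < l

/-- The control equations for an exponent vector `e`, that is, for the monomial
`A_1^{u_1} ⋯ A_n^{u_n} B_1^{v_1} ⋯ B_n^{v_n}` with `n = m + 1`, `u_k = e (Sum.inl k)` and
`v_k = e (Sum.inr k)`. For `i : Fin m` the two neighbours `i.castSucc`, `i.succ : Fin (m + 1)` are
the positions `i` and `i + 1`. -/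
def Control (D : SymmetricMatching m) (e : Fin (m + 1) ⊕ Fin (m + 1) →₀ ℕ) : Prop :=
  ∀ i j : Fin m,
    (D.Θ (Sum.inl i) = Sum.inr j →
      e (Sum.inl i.castSucc) + e (Sum.inl i.succ) = e (Sum.inr j.castSucc) + e (Sum.inr j.succ) ∧
      e (Sum.inl j.castSucc) + e (Sum.inl j.succ) = e (Sum.inr i.castSucc) + e (Sum.inr i.succ)) ∧
    (D.Θ (Sum.inl i) = Sum.inl j →
      e (Sum.inl i.castSucc) + e (Sum.inl i.succ) = e (Sum.inl j.castSucc) + e (Sum.inl j.succ) ∧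
      e (Sum.inr j.castSucc) + e (Sum.inr j.succ) = e (Sum.inr i.castSucc) + e (Sum.inr i.succ))

theorem control_zero (D : SymmetricMatching m) : D.Control 0 := by
  intro i j
  simp

theorem Control.add {D : SymmetricMatching m} {e f : Fin (m + 1) ⊕ Fin (m + 1) →₀ ℕ}
    (he : D.Control e) (hf : D.Control f) : D.Control (e + f) := by
  intro i j
  refine ⟨fun h => ?_, fun h => ?_⟩
  · have h1 := (he i j).1 h
    have h2 := (hf i j).1 h
    simp only [Finsupp.add_apply]
    omega
  · have h1 := (he i j).2 h
    have h2 := (hf i j).2 h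
    simp only [Finsupp.add_apply]
    omega

/-- The matching ring `S(Θ)`: the subring of `K[A_1, …, A_n, B_1, …, B_n]` (`n = m + 1`, with
`A_k = X (Sum.inl k)` and `B_k = X (Sum.inr k)`) whose elements are the `K`-linear combinations of
the monomials satisfying the control equations. -/
def matchingRing (D : SymmetricMatching m) (K : Type*) [Field K] :
    Subalgebra K (MvPolynomial (Fin (m + 1) ⊕ Fin (m + 1)) K) where
  carrier := {p | ∀ e ∈ p.support, D.Control e}
  mul_mem' := by
    classical
    intro p q hp hq e he
    obtain ⟨a, ha, b, hb, rfl⟩ := Finset.mem_add.1 (MvPolynomial.support_mul p q he)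
    exact (hp a ha).add (hq b hb)
  add_mem' := by
    classical
    intro p q hp hq e he
    rcases Finset.mem_union.1 (MvPolynomial.support_add he) with h | h
    · exact hp e h
    · exact hq e h
  algebraMap_mem' := by
    classical
    intro r e he
    rw [MvPolynomial.algebraMap_eq, MvPolynomial.mem_support_iff, MvPolynomial.coeff_C] at he
    have h0 : 0 = e := by
      by_contra h
      exact he (if_neg h)
    rw [← h0]
    exact D.control_zero

end SymmetricMatching

/-- A commutative `K`-algebra `S` is a complete intersection if it has a presentation
`S ≅ K[X_1, …, X_N] / (f_1, …, f_c)`, as a `K`-algebra, in which `f_1, …, f_c` is a regular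
sequence (with `N, c ≥ 0`, and nonzero quotient). The polynomial ring being Cohen–Macaulay, the
ideals generated by a regular sequence of length `c` are exactly the proper ideals of codimension
`c` that can be generated by `c` elements. -/
def IsCompleteIntersectionAlgebra (K S : Type*) [Field K] [CommRing S] [Algebra K S] : Prop :=
  ∃ (N : ℕ) (fs : List (MvPolynomial (Fin N) K)),
    RingTheory.Sequence.IsRegular (MvPolynomial (Fin N) K) fs ∧
    Nonempty ((MvPolynomial (Fin N) K ⧸ Ideal.ofList fs) ≃ₐ[K] S)

/-! `S(Θ)` is the monoid algebra of the exponent vectors satisfying the control equations.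
Exchanging `A` and `B` at odd positions turns these, by evenness, into `p_i + q_{i+1} = p_{σ(i)+1} +
q_{σ(i)}`, where `σ` is the involution of linked indices.

One device is used throughout, `addMonoidAlgebra_of_grading`. Let `δ : M → ℤ` have elements `u`, `v`
of degrees `1`, `-1` such that `u` splits off every element of positive degree and `v` every element
of negative degree. Then `K[M] = K[N][U, V]/(UV - X^(u+v))` with `N` the degree-zero part, so the
complete intersection property passes from `K[N]` to `K[M]`.

Noncrossing makes `p - q` agree at `i` and `σ(i)+1` (`eq_of_noncrossing_of_increments_neg`).
Removing the resulting classes of positions one by one, with `δ = p - q` on the class, reduces to `p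
= q` (`addMonoidAlgebra_pairSubmonoid`). There an arc joining neighbouring edges `i`, `i+1` only
says `m_i = m_{i+2}`. With at most five edges there is at most one longer arc, or exactly one nested
pair of them. At most one more use of the device leads to a monoid defined by equalities of
coordinates, which is free. -/

open RingTheory.Sequence in
theorem isCompleteIntersectionAlgebra_iff {K S : Type*} [Field K] [CommRing S] [Algebra K S]
    [Nontrivial S] :
    IsCompleteIntersectionAlgebra K S ↔
      ∃ (N : ℕ) (fs : List (MvPolynomial (Fin N) K)) (φ : MvPolynomial (Fin N) K →ₐ[K] S),
        IsWeaklyRegular (MvPolynomial (Fin N) K) fs ∧ Function.Surjective φ ∧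
          RingHom.ker φ = Ideal.ofList fs := by
  constructor
  · rintro ⟨N, fs, hfs, ⟨e⟩⟩
    refine ⟨N, fs, e.toAlgHom.comp (Ideal.Quotient.mkₐ K _), hfs.toIsWeaklyRegular,
      e.surjective.comp Ideal.Quotient.mk_surjective, ?_⟩
    ext x
    simp [RingHom.mem_ker, Ideal.Quotient.eq_zero_iff_mem]
  · rintro ⟨N, fs, φ, hfs, hφ, hker⟩
    have e := (Ideal.quotientEquivAlgOfEq K hker.symm).trans
      (Ideal.quotientKerAlgEquivOfSurjective hφ)
    refine ⟨N, fs, ⟨hfs, ?_⟩, ⟨e⟩⟩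
    -- The ideal is proper because it is the kernel of a map to a nontrivial ring.
    rw [Ideal.smul_top_eq_map, Algebra.algebraMap_self, Ideal.map_id, ← hker]
    intro h
    refine RingHom.ker_ne_top φ ?_
    rw [Submodule.restrictScalars_self] at h
    exact h.symm

/-! ### Stability properties of complete intersections. -/

namespace IsCompleteIntersectionAlgebra

open RingTheory.Sequence Polynomial

variable {K A S : Type*} [Field K] [CommRing A] [Algebra K A] [CommRing S] [Algebra K S]

theorem of_algEquiv (e : A ≃ₐ[K] S) (h : IsCompleteIntersectionAlgebra K A) :
    IsCompleteIntersectionAlgebra K S := by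
  obtain ⟨N, fs, hfs, ⟨e'⟩⟩ := h
  exact ⟨N, fs, hfs, ⟨e'.trans e⟩⟩

theorem mvPolynomial (K : Type*) [Field K] (Q : Type*) [Finite Q] :
    IsCompleteIntersectionAlgebra K (MvPolynomial Q K) := by
  obtain ⟨N, ⟨e⟩⟩ := Finite.exists_equiv_fin Q
  rw [isCompleteIntersectionAlgebra_iff]
  refine ⟨N, [], (MvPolynomial.renameEquiv K e.symm).toAlgHom, .nil _ _,
    (MvPolynomial.renameEquiv K e.symm).surjective, ?_⟩
  rw [Ideal.ofList_nil]
  exact (RingHom.injective_iff_ker_eq_bot _).1 (MvPolynomial.renameEquiv K e.symm).injective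

/-- A polynomial ring over a complete intersection is a complete intersection. -/
theorem polynomial [Nontrivial A] (h : IsCompleteIntersectionAlgebra K A) :
    IsCompleteIntersectionAlgebra K A[X] := by
  rw [isCompleteIntersectionAlgebra_iff] at h ⊢
  obtain ⟨N, fs, φ, hfs, hφ, hker⟩ := h
  let e := MvPolynomial.finSuccEquiv K N
  refine ⟨N + 1, (fs.map C).map (e.symm : _ →+* _), (Polynomial.mapAlgHom φ).comp e.toAlgHom,
    ?_, ?_, ?_⟩
  -- Weak regularity survives the flat extension by one variable.
  · have h1 : IsWeaklyRegular (MvPolynomial (Fin N) K)[X] (fs.map C) := hfs.of_flat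
    refine (AddEquiv.isWeaklyRegular_congr (e := e.symm.toRingEquiv.toAddEquiv) ?_).1 h1
    exact List.forall₂_map_right_iff.mpr <| List.forall₂_same.mpr fun r _ x => by simp
  · exact (Polynomial.map_surjective _ hφ).comp e.surjective
  · rw [← Ideal.map_ofList, ← Ideal.map_ofList, ← hker]
    have h2 := Polynomial.ker_mapRingHom (φ : MvPolynomial (Fin N) K →+* A)
    change _ = Ideal.map _ (Ideal.map C (RingHom.ker (φ : MvPolynomial (Fin N) K →+* A)))
    rw [← h2]
    change _ = Ideal.map (e.toRingEquiv.symm) _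
    rw [Ideal.map_symm]
    rfl

/-- Dividing a complete intersection by a nonzerodivisor gives a complete intersection. -/
theorem of_surjective [Nontrivial A] [Nontrivial S] (h : IsCompleteIntersectionAlgebra K A)
    (ψ : A →ₐ[K] S) (hψ : Function.Surjective ψ) {f : A} (hf : f ∈ nonZeroDivisors A)
    (hker : RingHom.ker ψ = Ideal.span {f}) : IsCompleteIntersectionAlgebra K S := by
  rw [isCompleteIntersectionAlgebra_iff] at h ⊢
  obtain ⟨N, fs, φ, hfs, hφ, hk⟩ := h
  obtain ⟨F, rfl⟩ := hφ f
  refine ⟨N, fs ++ [F], ψ.comp φ, ?_, hψ.comp hφ, ?_⟩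
  · rw [isWeaklyRegular_append_iff]
    refine ⟨hfs, ?_⟩
    rw [isWeaklyRegular_cons_iff, and_iff_left (.nil _ _)]
    have hI : (Ideal.ofList fs • ⊤ : Submodule (MvPolynomial (Fin N) K) (MvPolynomial (Fin N) K))
        = RingHom.ker φ := by
      rw [hk, Ideal.smul_eq_mul, Ideal.mul_top]
    rw [hI, isSMulRegular_iff_right_eq_zero_of_smul]
    intro x
    induction x using Submodule.Quotient.induction_on with | _ x
    intro hx
    rw [← Submodule.Quotient.mk_smul, Submodule.Quotient.mk_eq_zero, RingHom.mem_ker,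
      smul_eq_mul, map_mul] at hx
    rw [Submodule.Quotient.mk_eq_zero, RingHom.mem_ker]
    exact (mem_nonZeroDivisors_iff.1 hf).1 _ hx
  · rw [Ideal.ofList_append, Ideal.ofList_singleton, ← hk]
    apply le_antisymm
    · intro x hx
      have hx' : φ x ∈ RingHom.ker ψ := hx
      rw [hker, Ideal.mem_span_singleton'] at hx'
      obtain ⟨a, ha⟩ := hx'
      obtain ⟨y, rfl⟩ := hφ a
      rw [← sub_add_cancel x (y * F)]
      refine Ideal.add_mem _ (Ideal.mem_sup_left ?_)
        (Ideal.mem_sup_right (Ideal.mul_mem_left _ _ (Ideal.mem_span_singleton_self F)))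
      simp [RingHom.mem_ker, ha]
    · rw [sup_le_iff, Ideal.span_singleton_le_iff_mem]
      refine ⟨fun x hx => ?_, ?_⟩
      · have : φ x = 0 := hx
        simp [RingHom.mem_ker, this]
      · change φ F ∈ RingHom.ker ψ
        rw [hker]
        exact Ideal.mem_span_singleton_self _

/-- `A[X][Y]/(XY - a)` is a complete intersection if `A` is. -/
theorem of_surjective_pair [Nontrivial A] [Nontrivial S] (h : IsCompleteIntersectionAlgebra K A)
    (ψ : A[X][X] →ₐ[K] S) (hψ : Function.Surjective ψ) (a : A)
    (hker : RingHom.ker ψ = Ideal.span {C X * X - C (C a)}) :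
    IsCompleteIntersectionAlgebra K S := by
  refine of_surjective h.polynomial.polynomial ψ hψ
    (Polynomial.mem_nonZeroDivisors_of_leadingCoeff ?_) hker
  -- As a polynomial in the outer variable, the relation is linear with leading coefficient the
  -- inner variable, a nonzerodivisor.
  have h1 : (C (X : A[X]) * X - C (C a)).leadingCoeff = X := by
    rw [sub_eq_add_neg, ← C_neg]
    exact leadingCoeff_linear X_ne_zero
  rw [h1]
  exact Polynomial.mem_nonZeroDivisors_of_leadingCoeff (by simp)

end IsCompleteIntersectionAlgebra

/-! ### Monoid algebras graded by the integers. -/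

namespace IsCompleteIntersectionAlgebra

open Polynomial

variable {K A S : Type*} [Field K] [CommRing A] [Algebra K A] [CommRing S] [Algebra K S]

/-- The ideal `(UV - a)` of `A[V][U]`. -/
noncomputable def pairIdeal (a : A) : Ideal A[X][X] := Ideal.span {C X * X - C (C a)}

/-- Replaces `(UV)^t` by `a^t`; this makes the map `χ` on a graded monoid algebra independent of the
chosen decompositions. -/
theorem mk_monomial_add (a s : A) (i j t : ℕ) :
    Ideal.Quotient.mk (pairIdeal a) (monomial (i + t) (monomial (j + t) s)) =
      Ideal.Quotient.mk (pairIdeal a) (monomial i (monomial j (s * a ^ t))) := by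
  have h1 : Ideal.Quotient.mk (pairIdeal a) (C X * X) = Ideal.Quotient.mk (pairIdeal a) (C (C a)) :=
    Ideal.Quotient.eq.2 (Ideal.mem_span_singleton_self _)
  have h2 : (monomial (i + t) (monomial (j + t) s) : A[X][X]) =
      monomial i (monomial j s) * (C X * X) ^ t := by
    rw [mul_pow, ← C_pow, mul_left_comm, monomial_mul_X_pow, C_mul_monomial, X_pow_mul,
      monomial_mul_X_pow]
  rw [h2, map_mul, map_pow, h1, ← map_pow, ← map_mul, ← C_pow, ← C_pow, monomial_mul_C,
    monomial_mul_C]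

/-- A presentation `S = A[U, V]/(UV - a)`, where `U, V` go to `x, y`, obtained from an additive
section `χ`. -/
theorem of_pair [Nontrivial A] [Nontrivial S] (h : IsCompleteIntersectionAlgebra K A)
    (f : A →ₐ[K] S) (x y : S) (a : A) (hxy : f a = x * y) (χ : S →+ A[X][X] ⧸ pairIdeal a)
    (hχ : ∀ i j s, χ (f s * y ^ j * x ^ i) =
      Ideal.Quotient.mk (pairIdeal a) (monomial i (monomial j s)))
    (hspan : ∀ s, s ∈ AddSubmonoid.closure {s | ∃ i j t, s = f t * y ^ j * x ^ i}) :
    IsCompleteIntersectionAlgebra K S := by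
  let ψ : A[X][X] →ₐ[K] S := aevalTower (aevalTower f y) x
  have hψ (i j : ℕ) (s : A) : ψ (monomial i (monomial j s)) = f s * y ^ j * x ^ i := by
    simp [ψ, ← C_mul_X_pow_eq_monomial]
  -- Since `χ ∘ ψ` is the quotient map, whatever `ψ` kills lies in `pairIdeal a`.
  have hχψ : χ.comp (ψ : A[X][X] →+ S) =
      (Ideal.Quotient.mk (pairIdeal a)).toAddMonoidHom := by
    refine Polynomial.addHom_ext' fun i => Polynomial.addHom_ext' fun j => AddMonoidHom.ext fun s => ?_
    change χ (ψ (monomial i (monomial j s))) = Ideal.Quotient.mk _ (monomial i (monomial j s))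
    rw [hψ, hχ]
  refine of_surjective_pair h ψ ?_ a (le_antisymm ?_ ?_)
  · intro s
    have h1 : AddSubmonoid.closure {s | ∃ i j t, s = f t * y ^ j * x ^ i} ≤
        AddMonoidHom.mrange (ψ : A[X][X] →+ S) := by
      rw [AddSubmonoid.closure_le]
      rintro _ ⟨i, j, t, rfl⟩
      exact ⟨_, hψ i j t⟩
    exact h1 (hspan s)
  · intro p hp
    have h1 := DFunLike.congr_fun hχψ p
    have h2 : ψ p = 0 := hp
    change χ (ψ p) = Ideal.Quotient.mk _ p at h1
    rw [h2, map_zero] at h1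
    exact Ideal.Quotient.eq_zero_iff_mem.1 h1.symm
  · rw [Ideal.span_singleton_le_iff_mem, RingHom.mem_ker]
    simp [ψ, hxy, mul_comm y x]

/-- If every element of the monoid `M` is an element of `N = M ∩ ker δ` plus a multiple of `u` or
of `v`, where `δ u = 1` and `δ v = -1`, then `K[M]` is `K[N][U, V]/(UV - X^(u + v))`. -/
theorem addMonoidAlgebra_of_grading {K G : Type*} [Field K] [AddCancelCommMonoid G]
    (M N : AddSubmonoid G) (δ : G →+ ℤ) (hN : ∀ x, x ∈ N ↔ x ∈ M ∧ δ x = 0)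
    {u v : G} (hu : u ∈ M) (hv : v ∈ M) (hδu : δ u = 1) (hδv : δ v = -1)
    (hpos : ∀ x ∈ M, 0 < δ x → ∃ y ∈ M, x = y + u)
    (hneg : ∀ x ∈ M, δ x < 0 → ∃ y ∈ M, x = y + v)
    (h : IsCompleteIntersectionAlgebra K (AddMonoidAlgebra K N)) :
    IsCompleteIntersectionAlgebra K (AddMonoidAlgebra K M) := by
  classical
  have hle : N ≤ M := fun x hx => ((hN x).1 hx).1
  have huv : u + v ∈ N := (hN _).2 ⟨add_mem hu hv, by rw [map_add, hδu, hδv]; rfl⟩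
  let w : N := ⟨u + v, huv⟩
  let ι : N →+ M := AddSubmonoid.inclusion hle
  let u' : M := ⟨u, hu⟩
  let v' : M := ⟨v, hv⟩
  have hιw : ι w = u' + v' := rfl
  let f := AddMonoidAlgebra.mapDomainAlgHom K K ι
  let a : AddMonoidAlgebra K N := AddMonoidAlgebra.single w 1
  have hf (i j : ℕ) (n : N) (c : K) : f (AddMonoidAlgebra.single n c) *
      AddMonoidAlgebra.single v' 1 ^ j * AddMonoidAlgebra.single u' 1 ^ i =
      AddMonoidAlgebra.single (ι n + j • v' + i • u') c := by
    simp [f, AddMonoidAlgebra.single_pow, AddMonoidAlgebra.single_mul_single]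
  -- Each subtraction of `u` or `v` lowers `|δ x|` by one.
  have hrep (k : ℕ) : ∀ x : M, (δ x).natAbs = k → ∃ (i j : ℕ) (n : N),
      x = ι n + j • v' + i • u' := by
    induction k with
    | zero =>
      intro x hx
      exact ⟨0, 0, ⟨x, (hN _).2 ⟨x.2, by omega⟩⟩, by ext; simp [ι]⟩
    | succ k ih =>
      intro x hx
      rcases lt_or_ge 0 (δ x) with hd | hd
      · obtain ⟨y, hy, hxy⟩ := hpos x x.2 hd
        have hδ : δ x = δ y + 1 := by rw [hxy, map_add, hδu]
        obtain ⟨i, j, n, hn⟩ := ih ⟨y, hy⟩ (by simp only; omega)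
        refine ⟨i + 1, j, n, ?_⟩
        rw [add_smul, one_smul, ← add_assoc, ← hn]
        exact Subtype.ext hxy
      · obtain ⟨y, hy, hxy⟩ := hneg x x.2 (by omega)
        have hδ : δ x = δ y - 1 := by rw [hxy, map_add, hδv]; rfl
        obtain ⟨i, j, n, hn⟩ := ih ⟨y, hy⟩ (by simp only; omega)
        refine ⟨i, j + 1, n, ?_⟩
        rw [add_smul, one_smul, ← add_assoc, add_right_comm, ← hn]
        exact Subtype.ext hxy
  choose ri rj rn hr using fun x : M => hrep _ x rfl
  have hδrep (i j : ℕ) (n : N) : δ (ι n + j • v' + i • u' : M) = i - j := by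
    have : δ (n : G) = 0 := ((hN _).1 n.2).2
    simp [ι, u', v', this, hδu, hδv]
    ring
  have hmove (i j t : ℕ) (n n' : N)
      (he : ι n + j • v' + i • u' = ι n' + (j + t) • v' + (i + t) • u') : n = n' + t • w := by
    have h2 : ι n + (j • v' + i • u') = ι (n' + t • w) + (j • v' + i • u') := by
      rw [← add_assoc, he, map_add, map_nsmul, hιw]
      simp only [add_smul, smul_add]
      abel
    have h3 := add_right_cancel (congrArg (Subtype.val) h2 :
      (n : G) + ((j • v' + i • u' : M) : G) = ((n' + t • w : N) : G) + _)
    exact Subtype.ext h3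
  let g (i j : ℕ) (n : N) : K →+ (AddMonoidAlgebra K N)[X][X] ⧸ pairIdeal a :=
    (Ideal.Quotient.mk (pairIdeal a)).toAddMonoidHom.comp <|
      (monomial i).toAddMonoidHom.comp <| (monomial j).toAddMonoidHom.comp <|
        AddMonoidAlgebra.singleAddHom n
  have hg (i j : ℕ) (n : N) (c : K) : g i j n c =
      Ideal.Quotient.mk (pairIdeal a) (monomial i (monomial j (AddMonoidAlgebra.single n c))) := rfl
  have hat (n : N) (c : K) (t : ℕ) :
      AddMonoidAlgebra.single n c * a ^ t = AddMonoidAlgebra.single (n + t • w) c := by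
    rw [AddMonoidAlgebra.single_pow, AddMonoidAlgebra.single_mul_single, one_pow, mul_one]
  -- Decompositions are not unique, but `δ` fixes `i - j`. Two of them thus differ by trading copies
  -- of `u + v` for copies of `w` in `N`.
  have huniq (i j i' j' : ℕ) (n n' : N) (c : K)
      (he : ι n + j • v' + i • u' = ι n' + j' • v' + i' • u') : g i j n c = g i' j' n' c := by
    have hd := congrArg (fun z : M => δ z) he
    simp only [hδrep] at hd
    rcases le_total i i' with hi | hi
    · obtain ⟨t, rfl⟩ := Nat.exists_eq_add_of_le hi
      obtain rfl : j' = j + t := by omega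
      rw [hg, hg, mk_monomial_add, hmove _ _ _ _ _ he, hat]
    · obtain ⟨t, rfl⟩ := Nat.exists_eq_add_of_le hi
      obtain rfl : j = j' + t := by omega
      rw [hg, hg, mk_monomial_add, hmove _ _ _ _ _ he.symm, hat]
  let χ : AddMonoidAlgebra K M →+ (AddMonoidAlgebra K N)[X][X] ⧸ pairIdeal a :=
    (Finsupp.liftAddHom fun x : M => g (ri x) (rj x) (rn x)).comp
      AddMonoidAlgebra.coeffAddEquiv.toAddMonoidHom
  have hχ (x : M) (c : K) : χ (AddMonoidAlgebra.single x c) = g (ri x) (rj x) (rn x) c := by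
    simp [χ]
  refine of_pair h f (AddMonoidAlgebra.single u' 1) (AddMonoidAlgebra.single v' 1) a ?_ χ ?_ ?_
  · simp [f, a, hιw, AddMonoidAlgebra.single_mul_single]
  · intro i j s
    induction s using AddMonoidAlgebra.induction_linear with
    | zero => simp
    | add s t hs ht => simp only [map_add, add_mul, hs, ht]
    | single n c =>
      rw [hf, hχ, ← hg]
      exact huniq _ _ _ _ _ _ _ (hr _).symm
  · intro s
    induction s using AddMonoidAlgebra.induction_linear with
    | zero => exact zero_mem _
    | add s t hs ht => exact add_mem hs ht
    | single x c =>
      refine AddSubmonoid.subset_closure ⟨ri x, rj x, AddMonoidAlgebra.single (rn x) c, ?_⟩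
      rw [hf, ← hr]

end IsCompleteIntersectionAlgebra

/-! ### Monoids of functions cut out by linear equations. -/

namespace IsCompleteIntersectionAlgebra

variable {V : Type*} (K : Type*) [Field K]

/-- The functions `V → ℕ` respecting a relation form a free commutative monoid. -/
theorem addMonoidAlgebra_of_forall_eq [Finite V] (N : AddSubmonoid (V → ℕ)) (r : V → V → Prop)
    (hN : ∀ m, m ∈ N ↔ ∀ x y, r x y → m x = m y) :
    IsCompleteIntersectionAlgebra K (AddMonoidAlgebra K N) := by
  let e : N ≃+ (Quot r →₀ ℕ) :=
    { toFun := fun m => Finsupp.equivFunOnFinite.symm (Quot.lift m.1 ((hN _).1 m.2))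
      invFun := fun f => ⟨fun x => f (Quot.mk r x), (hN _).2 fun x y h => by rw [Quot.sound h]⟩
      left_inv := fun m => rfl
      right_inv := fun f => by
        ext q
        induction q using Quot.ind
        rfl
      map_add' := fun m m' => by
        ext q
        induction q using Quot.ind
        rfl }
  exact (mvPolynomial K (Quot r)).of_algEquiv (AddMonoidAlgebra.domCongr K K e.symm)

/-- The difference `m a - m b`, as an additive function of `m`. -/
def coordSub (a b : V) : (V → ℕ) →+ ℤ where
  toFun m := m a - m b
  map_zero' := by simp
  map_add' m m' := by simp only [Pi.add_apply]; push_cast; ring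

@[simp]
theorem coordSub_apply (a b : V) (m : V → ℕ) : coordSub a b m = m a - m b := rfl

/-- If a class occurs on both sides of the sum equation, it cancels and an equality of two values
remains. Otherwise grade by `m a - m c = m d - m b`: in degree zero the equation splits into `m a =
m c` and `m b = m d`. -/
theorem addMonoidAlgebra_of_forall_eq_of_add_eq_add [Finite V] (N : AddSubmonoid (V → ℕ))
    (r : V → V → Prop) (a b c d : V) (hab : Quot.mk r a ≠ Quot.mk r b)
    (hcd : Quot.mk r c ≠ Quot.mk r d)
    (hN : ∀ m, m ∈ N ↔ (∀ x y, r x y → m x = m y) ∧ m a + m b = m c + m d) :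
    IsCompleteIntersectionAlgebra K (AddMonoidAlgebra K N) := by
  classical
  have hq (m : V → ℕ) (hm : ∀ x y, r x y → m x = m y) (x y : V) (h : Quot.mk r x = Quot.mk r y) :
      m x = m y := congrArg (Quot.lift m hm) h
  have hfree (x y : V)
      (hxy : ∀ m : V → ℕ, (∀ x y, r x y → m x = m y) → (m a + m b = m c + m d ↔ m x = m y)) :
      IsCompleteIntersectionAlgebra K (AddMonoidAlgebra K N) := by
    refine addMonoidAlgebra_of_forall_eq K N (fun z w => r z w ∨ (z = x ∧ w = y)) fun m => ?_
    rw [hN]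
    constructor
    · rintro ⟨h1, h2⟩ z w (h | ⟨rfl, rfl⟩)
      · exact h1 z w h
      · exact (hxy m h1).1 h2
    · intro h
      have h1 : ∀ z w, r z w → m z = m w := fun z w hzw => h z w (.inl hzw)
      exact ⟨h1, (hxy m h1).2 (h x y (.inr ⟨rfl, rfl⟩))⟩
  by_cases hac : Quot.mk r a = Quot.mk r c
  · exact hfree b d fun m hm => by have := hq m hm _ _ hac; omega
  by_cases had : Quot.mk r a = Quot.mk r d
  · exact hfree b c fun m hm => by have := hq m hm _ _ had; omega
  by_cases hbc : Quot.mk r b = Quot.mk r c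
  · exact hfree a d fun m hm => by have := hq m hm _ _ hbc; omega
  by_cases hbd : Quot.mk r b = Quot.mk r d
  · exact hfree a c fun m hm => by have := hq m hm _ _ hbd; omega
  -- Indicator of two classes. `χ a d` has degree `1` and `χ b c` degree `-1`; when `m a > m c` also
  -- `m d > m b`, so `χ a d` can be subtracted.
  let χ (x y : V) : V → ℕ := fun z =>
    if Quot.mk r z = Quot.mk r x ∨ Quot.mk r z = Quot.mk r y then 1 else 0
  have hχ (x y z w : V) (h : r z w) : χ x y z = χ x y w := by simp only [χ, Quot.sound h]
  have hsub (x y : V) (m : V → ℕ) (hm : ∀ x y, r x y → m x = m y) (hx : 0 < m x) (hy : 0 < m y) :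
      ∃ m', (∀ x y, r x y → m' x = m' y) ∧ m = m' + χ x y := by
    refine ⟨m - χ x y, fun z w h => ?_, ?_⟩
    · simp only [Pi.sub_apply, hm z w h, hχ x y z w h]
    · ext z
      have : χ x y z ≤ m z := by
        by_cases hz : Quot.mk r z = Quot.mk r x ∨ Quot.mk r z = Quot.mk r y
        · simp only [χ, if_pos hz]
          rcases hz with hz | hz
          · rw [hq m hm _ _ hz]; exact hx
          · rw [hq m hm _ _ hz]; exact hy
        · simp [χ, if_neg hz]
      simp only [Pi.add_apply, Pi.sub_apply]
      omega
  have e1 : χ a d a = 1 := by simp [χ]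
  have e2 : χ a d b = 0 := by simp [χ, hab.symm, hbd]
  have e3 : χ a d c = 0 := by simp [χ, hcd, Ne.symm hac]
  have e4 : χ a d d = 1 := by simp [χ]
  have f1 : χ b c a = 0 := by simp [χ, hab, hac]
  have f2 : χ b c b = 1 := by simp [χ]
  have f3 : χ b c c = 1 := by simp [χ]
  have f4 : χ b c d = 0 := by simp [χ, hcd.symm, Ne.symm hbd]
  refine addMonoidAlgebra_of_grading N (N ⊓ AddMonoidHom.mker (coordSub a c)) (coordSub a c)
    (fun x => Iff.rfl) (u := χ a d) (v := χ b c) ((hN _).2 ⟨hχ _ _, by omega⟩)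
    ((hN _).2 ⟨hχ _ _, by omega⟩) (by simp [e1, e3]) (by simp [f1, f3]) ?_ ?_ ?_
  · intro m hm hpos
    rw [hN] at hm
    rw [coordSub_apply] at hpos
    obtain ⟨m', h1, rfl⟩ := hsub a d m hm.1 (by omega) (by omega)
    have := hm.2
    simp only [Pi.add_apply] at this
    exact ⟨m', (hN _).2 ⟨h1, by omega⟩, rfl⟩
  · intro m hm hneg
    rw [hN] at hm
    rw [coordSub_apply] at hneg
    obtain ⟨m', h1, rfl⟩ := hsub b c m hm.1 (by omega) (by omega)
    have := hm.2
    simp only [Pi.add_apply] at this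
    exact ⟨m', (hN _).2 ⟨h1, by omega⟩, rfl⟩
  · refine addMonoidAlgebra_of_forall_eq K _
      (fun z w => r z w ∨ (z = a ∧ w = c) ∨ (z = b ∧ w = d)) fun m => ?_
    rw [AddSubmonoid.mem_inf, hN, AddMonoidHom.mem_mker, coordSub_apply]
    constructor
    · rintro ⟨⟨h1, h2⟩, h3⟩ z w (h | ⟨rfl, rfl⟩ | ⟨rfl, rfl⟩)
      · exact h1 z w h
      · omega
      · omega
    · intro h
      have h1 := h a c (.inr (.inl ⟨rfl, rfl⟩))
      have h2 := h b d (.inr (.inr ⟨rfl, rfl⟩))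
      exact ⟨⟨fun z w hzw => h z w (.inl hzw), by omega⟩, by omega⟩

/-- The pairs `(p, q)` with `p (a i) + q (b i) = p (c i) + q (d i)` for all `i`. -/
def pairSubmonoid {I : Type*} (a b c d : I → V) : AddSubmonoid ((V → ℕ) × (V → ℕ)) where
  carrier := {x | ∀ i, x.1 (a i) + x.2 (b i) = x.1 (c i) + x.2 (d i)}
  zero_mem' i := by simp
  add_mem' {x y} hx hy i := by
    have h1 := hx i
    have h2 := hy i
    simp only [Prod.fst_add, Prod.snd_add, Pi.add_apply]
    omega

/-- The functions `m` with `m (a i) + m (b i) = m (c i) + m (d i)` for all `i`. -/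
def diagSubmonoid {I : Type*} (a b c d : I → V) : AddSubmonoid (V → ℕ) where
  carrier := {m | ∀ i, m (a i) + m (b i) = m (c i) + m (d i)}
  zero_mem' i := by simp
  add_mem' {x y} hx hy i := by
    have h1 := hx i
    have h2 := hy i
    simp only [Pi.add_apply]
    omega

theorem mem_pairSubmonoid {I : Type*} {a b c d : I → V} {x : (V → ℕ) × (V → ℕ)} :
    x ∈ pairSubmonoid a b c d ↔ ∀ i, x.1 (a i) + x.2 (b i) = x.1 (c i) + x.2 (d i) := Iff.rfl

theorem mem_diagSubmonoid {I : Type*} {a b c d : I → V} {m : V → ℕ} :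
    m ∈ diagSubmonoid a b c d ↔ ∀ i, m (a i) + m (b i) = m (c i) + m (d i) := Iff.rfl

/-- The difference `p w - q w`, as an additive function of `(p, q)`. -/
def pairSub (w : V) : (V → ℕ) × (V → ℕ) →+ ℤ where
  toFun x := x.1 w - x.2 w
  map_zero' := by simp
  map_add' x y := by simp only [Prod.fst_add, Prod.snd_add, Pi.add_apply]; push_cast; ring

@[simp]
theorem pairSub_apply (w : V) (x : (V → ℕ) × (V → ℕ)) : pairSub w x = x.1 w - x.2 w := rfl

/-- If `p - q` is constant on the classes of a relation for all pairs `(p, q)` of `pairSubmonoid`,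
and if `a i, c i` and `b i, d i` lie in the same class, then one may restrict to `p = q`. -/
theorem addMonoidAlgebra_pairSubmonoid [Finite V] {I : Type*} (a b c d : I → V)
    (hM : ∀ x ∈ pairSubmonoid a b c d, ∀ i,
      pairSub (a i) x = pairSub (c i) x ∧ pairSub (b i) x = pairSub (d i) x)
    (h : IsCompleteIntersectionAlgebra K (AddMonoidAlgebra K (diagSubmonoid a b c d))) :
    IsCompleteIntersectionAlgebra K (AddMonoidAlgebra K (pairSubmonoid a b c d)) := by
  classical
  let r : V → V → Prop := fun z w => ∃ i, (z = a i ∧ w = c i) ∨ (z = b i ∧ w = d i)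
  have hac (i : I) : Quot.mk r (a i) = Quot.mk r (c i) := Quot.sound ⟨i, .inl ⟨rfl, rfl⟩⟩
  have hbd (i : I) : Quot.mk r (b i) = Quot.mk r (d i) := Quot.sound ⟨i, .inr ⟨rfl, rfl⟩⟩
  have hconst (x) (hx : x ∈ pairSubmonoid a b c d) (z w : V) (hzw : Quot.mk r z = Quot.mk r w) :
      pairSub z x = pairSub w x := by
    refine congrArg (Quot.lift (fun z => pairSub z x) ?_) hzw
    rintro _ _ ⟨i, ⟨rfl, rfl⟩ | ⟨rfl, rfl⟩⟩
    · exact (hM x hx i).1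
    · exact (hM x hx i).2
  -- Pairs with `p = q` outside the classes in `T`: the diagonal for `T` empty, the whole monoid for
  -- `T` full.
  let L (T : Finset (Quot r)) : AddSubmonoid ((V → ℕ) × (V → ℕ)) :=
    pairSubmonoid a b c d ⊓ ⨅ z : {z : V // Quot.mk r z ∉ T}, AddMonoidHom.mker (pairSub z.1)
  have hL (T : Finset (Quot r)) (x) : x ∈ L T ↔
      x ∈ pairSubmonoid a b c d ∧ ∀ z, Quot.mk r z ∉ T → pairSub z x = 0 := by
    simp only [L, AddSubmonoid.mem_inf, AddSubmonoid.mem_iInf, AddMonoidHom.mem_mker,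
      Subtype.forall]
  have key (T : Finset (Quot r)) : IsCompleteIntersectionAlgebra K (AddMonoidAlgebra K (L T)) := by
    induction T using Finset.induction_on with
    | empty =>
      let e : diagSubmonoid a b c d ≃+ L ∅ :=
        { toFun := fun m => ⟨(m.1, m.1), (hL _ _).2 ⟨m.2, by simp⟩⟩
          invFun := fun x => ⟨x.1.1, fun i => by
            have h1 := ((hL _ _).1 x.2).1 i
            have h2 := ((hL _ _).1 x.2).2 (b i) (by simp)
            have h3 := ((hL _ _).1 x.2).2 (d i) (by simp)
            simp only [pairSub_apply] at h2 h3
            omega⟩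
          left_inv := fun m => rfl
          right_inv := fun x => by
            refine Subtype.ext (Prod.ext rfl (funext fun z => ?_))
            have h2 := ((hL _ _).1 x.2).2 z (by simp)
            simp only [pairSub_apply] at h2
            change x.1.1 z = x.1.2 z
            omega
          map_add' := fun m m' => rfl }
      exact h.of_algEquiv (AddMonoidAlgebra.domCongr K K e)
    | insert κ T hκ ih =>
      obtain ⟨w, rfl⟩ := Quot.exists_rep κ
      let χ : V → ℕ := fun z => if Quot.mk r z = Quot.mk r w then 1 else 0
      have hχac (i : I) : χ (a i) = χ (c i) := by simp only [χ, hac]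
      have hχbd (i : I) : χ (b i) = χ (d i) := by simp only [χ, hbd]
      have hχw : χ w = 1 := by simp [χ]
      have hχT (z : V) (hz : Quot.mk r z ∉ insert (Quot.mk r w) T) : χ z = 0 := by
        rw [Finset.mem_insert, not_or] at hz
        simp [χ, hz.1]
      have hle (f : V → ℕ) (hf : ∀ z, Quot.mk r z = Quot.mk r w → 0 < f z) : f = (f - χ) + χ := by
        ext z
        simp only [Pi.add_apply, Pi.sub_apply]
        by_cases hz : Quot.mk r z = Quot.mk r w
        · have := hf z hz
          simp only [χ, if_pos hz]
          omega
        · simp [χ, hz]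
      refine addMonoidAlgebra_of_grading (L (insert (Quot.mk r w) T)) (L T) (pairSub w) ?_
        (u := (χ, 0)) (v := (0, χ)) ((hL _ _).2 ⟨fun i => by simp [hχac], ?_⟩)
        ((hL _ _).2 ⟨fun i => by simp [hχbd], ?_⟩) (by simp [hχw]) (by simp [hχw]) ?_ ?_ ih
      · intro x
        rw [hL, hL, and_assoc]
        refine and_congr_right fun hx => ?_
        constructor
        · intro h1
          exact ⟨fun z hz => h1 z fun hz' => hz (Finset.mem_insert_of_mem hz'), h1 w hκ⟩
        · rintro ⟨h1, h2⟩ z hz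
          by_cases hzw : Quot.mk r z = Quot.mk r w
          · rw [hconst x hx z w hzw, h2]
          · exact h1 z (by simp [hz, hzw])
      · intro z hz
        simp [hχT z hz]
      · intro z hz
        simp [hχT z hz]
      · rintro ⟨p, q⟩ hx hpos
        obtain ⟨h1, h2⟩ := (hL _ _).1 hx
        -- As `p - q` is constant on the class of `w`, its positivity at `w` forces `p > 0` on the
        -- whole class.
        have hp := hle p fun z hz => by
          rw [← hconst _ h1 z w hz, pairSub_apply] at hpos
          simp only at hpos
          omega
        refine ⟨(p - χ, q), (hL _ _).2 ⟨fun i => ?_, fun z hz => ?_⟩, Prod.ext hp (by simp)⟩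
        · have := h1 i
          rw [hp] at this
          simp only [Pi.add_apply, hχac] at this ⊢
          omega
        · have := h2 z hz
          simp only [pairSub_apply, Pi.sub_apply, hχT z hz] at this ⊢
          omega
      · rintro ⟨p, q⟩ hx hneg
        obtain ⟨h1, h2⟩ := (hL _ _).1 hx
        have hq := hle q fun z hz => by
          rw [← hconst _ h1 z w hz, pairSub_apply] at hneg
          simp only at hneg
          omega
        refine ⟨(p, q - χ), (hL _ _).2 ⟨fun i => ?_, fun z hz => ?_⟩, Prod.ext (by simp) hq⟩
        · have := h1 i
          rw [hq] at this
          simp only [Pi.add_apply, hχbd] at this ⊢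
          omega
        · have := h2 z hz
          simp only [pairSub_apply, Pi.sub_apply, hχT z hz] at this ⊢
          omega
  have : Fintype (Quot r) := Fintype.ofFinite _
  have hU : L Finset.univ = pairSubmonoid a b c d := by
    ext x
    simp [hL]
  rw [← hU]
  exact key _

end IsCompleteIntersectionAlgebra

/-! ### Noncrossing involutions of the edges of a path. -/

/-- Along a noncrossing involution of the edges of a path, if the increments of `f` along matched
edges are opposite, then matched end points have the same value. -/
theorem eq_of_noncrossing_of_increments_neg {m : ℕ} {σ : Fin m → Fin m}
    (hσ : Function.Involutive σ) (hnc : ∀ i j, i < j → j < σ i → σ i < σ j → False)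
    (f : Fin (m + 1) → ℤ)
    (hf : ∀ i, f i.castSucc - f i.succ = f (σ i).succ - f (σ i).castSucc) (i : Fin m) :
    f i.castSucc = f (σ i).succ := by
  have inner (i : Fin m) (hi : i < σ i) : f i.succ = f (σ i).castSucc := by
    have hσmem (k : Fin m) (hk : k ∈ Finset.Ioo i (σ i)) : σ k ∈ Finset.Ioo i (σ i) := by
      rw [Finset.mem_Ioo] at hk ⊢
      constructor
      · by_contra hlt
        rcases (not_lt.1 hlt).lt_or_eq with h | h
        · exact hnc (σ k) i h (by rw [hσ]; exact hk.1) (by rw [hσ]; exact hk.2)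
        · exact hk.2.ne (by rw [← h, hσ])
      · by_contra hlt
        rcases (not_lt.1 hlt).lt_or_eq with h | h
        · exact hnc i k hk.1 hk.2 h
        · exact hk.1.ne (hσ.injective h)
    -- The open interval under an arc is `σ`-stable, and `σ` negates increments, so the sum equals
    -- its own negative.
    have h0 : ∑ k ∈ Finset.Ioo i (σ i), (f k.succ - f k.castSucc) = 0 := by
      have h1 : ∑ k ∈ Finset.Ioo i (σ i), (f k.succ - f k.castSucc) =
          ∑ k ∈ Finset.Ioo i (σ i), (f (σ k).succ - f (σ k).castSucc) :=
        Finset.sum_nbij' σ σ hσmem hσmem (fun k _ => hσ k) (fun k _ => hσ k)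
          fun k _ => by rw [hσ]
      have h2 : ∑ k ∈ Finset.Ioo i (σ i), (f (σ k).succ - f (σ k).castSucc) =
          -∑ k ∈ Finset.Ioo i (σ i), (f k.succ - f k.castSucc) := by
        rw [← Finset.sum_neg_distrib]
        exact Finset.sum_congr rfl fun k _ => by rw [← hf k]; ring
      omega
    -- Extension to `ℕ` for telescoping; only values at vertices enter, never the default `0`.
    let F : ℕ → ℤ := fun n => if h : n < m + 1 then f ⟨n, h⟩ else 0
    have hF (x : Fin (m + 1)) : f x = F x := by
      simp only [F, dif_pos x.2]
    have h3 : ∑ k ∈ Finset.Ioo i (σ i), (f k.succ - f k.castSucc) =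
        ∑ n ∈ Finset.Ico ((i : ℕ) + 1) (σ i), (F (n + 1) - F n) := by
      have : Finset.Ico ((i : ℕ) + 1) (σ i) = (Finset.Ioo i (σ i)).map Fin.valEmbedding := by
        rw [Fin.map_valEmbedding_Ioo]
        ext n
        simp only [Finset.mem_Ico, Finset.mem_Ioo]
        omega
      rw [this, Finset.sum_map]
      exact Finset.sum_congr rfl fun k _ => by rw [hF, hF]; rfl
    rw [h0, Finset.sum_Ico_sub _ (by omega)] at h3
    rw [hF, hF, Fin.val_succ, Fin.val_castSucc]
    omega
  rcases lt_trichotomy i (σ i) with h | h | h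
  · have h1 := inner i h
    have h2 := hf i
    omega
  -- At a fixed edge the increment equals its negative, hence vanishes.
  · have h2 := hf i
    rw [← h] at h2 ⊢
    omega
  · have h1 := inner (σ i) (by rw [hσ]; exact h)
    rw [hσ] at h1
    exact h1.symm

namespace IsCompleteIntersectionAlgebra

/-- The equations say `f 0 - f 5 = f 4 - f 1 = f 2 - f 3`. This common value is the degree; the
alternating vectors `u` and `v` have degrees `1` and `-1`, and degree zero means that `f` is a
palindrome. -/
theorem addMonoidAlgebra_of_nested_pair (K : Type*) [Field K] (N : AddSubmonoid (Fin 6 → ℕ))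
    (hN : ∀ f, f ∈ N ↔ f 0 + f 1 = f 5 + f 4 ∧ f 1 + f 2 = f 4 + f 3) :
    IsCompleteIntersectionAlgebra K (AddMonoidAlgebra K N) := by
  refine addMonoidAlgebra_of_grading N (N ⊓ AddMonoidHom.mker (coordSub 0 5)) (coordSub 0 5)
    (fun x => Iff.rfl) (u := ![1, 0, 1, 0, 1, 0]) (v := ![0, 1, 0, 1, 0, 1])
    ((hN _).2 ⟨rfl, rfl⟩) ((hN _).2 ⟨rfl, rfl⟩) rfl rfl ?_ ?_ ?_
  · intro f hf hpos
    rw [hN] at hf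
    rw [coordSub_apply] at hpos
    refine ⟨![f 0 - 1, f 1, f 2 - 1, f 3, f 4 - 1, f 5], (hN _).2 ?_, ?_⟩
    · change f 0 - 1 + f 1 = f 5 + (f 4 - 1) ∧ f 1 + (f 2 - 1) = f 4 - 1 + f 3
      omega
    · ext k
      fin_cases k <;> simp <;> omega
  · intro f hf hneg
    rw [hN] at hf
    rw [coordSub_apply] at hneg
    refine ⟨![f 0, f 1 - 1, f 2, f 3 - 1, f 4, f 5 - 1], (hN _).2 ?_, ?_⟩
    · change f 0 + (f 1 - 1) = f 5 - 1 + f 4 ∧ f 1 - 1 + f 2 = f 4 + (f 3 - 1)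
      omega
    · ext k
      fin_cases k <;> simp <;> omega
  · refine addMonoidAlgebra_of_forall_eq K _
      (fun x y => x = 0 ∧ y = 5 ∨ x = 1 ∧ y = 4 ∨ x = 2 ∧ y = 3) fun f => ?_
    rw [AddSubmonoid.mem_inf, hN, AddMonoidHom.mem_mker, coordSub_apply]
    constructor
    · rintro ⟨h1, h2⟩ x y (⟨rfl, rfl⟩ | ⟨rfl, rfl⟩ | ⟨rfl, rfl⟩) <;> omega
    · intro h
      have h1 := h 0 5 (by simp)
      have h2 := h 1 4 (by simp)
      have h3 := h 2 3 (by simp)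
      omega

/-- The monoid of functions on the vertices of a path with at most five edges, whose sums along
edges matched by a noncrossing involution agree. -/
theorem addMonoidAlgebra_diagSubmonoid (K : Type*) [Field K] {m : ℕ} (hm : m ≤ 5)
    {σ : Fin m → Fin m} (hσ : Function.Involutive σ)
    (hnc : ∀ i j, i < j → j < σ i → σ i < σ j → False) :
    IsCompleteIntersectionAlgebra K (AddMonoidAlgebra K (diagSubmonoid (V := Fin (m + 1))
      Fin.castSucc Fin.succ (fun i => (σ i).succ) fun i => (σ i).castSucc)) := by
  -- A short arc from `k` to `k + 1` shares the vertex `k + 1`, which cancels and leaves `f k = f (k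
  -- + 2)`.
  let r : Fin (m + 1) → Fin (m + 1) → Prop := fun x y =>
    ∃ k : Fin m, (σ k : ℕ) = k + 1 ∧ x = k.castSucc ∧ y = (σ k).succ
  have hmem (f : Fin (m + 1) → ℕ) : f ∈ diagSubmonoid (V := Fin (m + 1))
      Fin.castSucc Fin.succ (fun i => (σ i).succ) (fun i => (σ i).castSucc) ↔
      (∀ x y, r x y → f x = f y) ∧ ∀ i : Fin m, (i : ℕ) + 2 ≤ σ i →
        f i.castSucc + f i.succ = f (σ i).succ + f (σ i).castSucc := by
    have hshort (k : Fin m) (hk : (σ k : ℕ) = k + 1) : (σ k).castSucc = k.succ := Fin.ext hk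
    rw [mem_diagSubmonoid]
    constructor
    · refine fun h => ⟨?_, fun i _ => h i⟩
      rintro _ _ ⟨k, hk, rfl, rfl⟩
      have := h k
      rw [hshort k hk] at this
      omega
    · rintro ⟨h1, h2⟩
      have hlt (i : Fin m) (hi : i < σ i) :
          f i.castSucc + f i.succ = f (σ i).succ + f (σ i).castSucc := by
        rcases Nat.lt_or_ge (σ i) (i + 2) with h | h
        · have hk : (σ i : ℕ) = i + 1 := by omega
          rw [hshort i hk, h1 _ _ ⟨i, hk, rfl, rfl⟩]
        · exact h2 i h
      intro i
      rcases lt_trichotomy i (σ i) with h | h | h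
      · exact hlt i h
      · rw [← h, add_comm]
      · have := hlt (σ i) (by rwa [hσ])
        rw [hσ] at this
        omega
  by_cases hlong : ∃ i : Fin m, (i : ℕ) + 2 ≤ σ i
  · obtain ⟨i, hi⟩ := hlong
    by_cases hlong' : ∃ k : Fin m, (k : ℕ) + 2 ≤ σ k ∧ k ≠ i
    · have two (i k : Fin m) (hi : (i : ℕ) + 2 ≤ σ i) (hk : (k : ℕ) + 2 ≤ σ k) (hik : i < k) :
          m = 5 ∧ (i : ℕ) = 0 ∧ (k : ℕ) = 1 ∧ (σ k : ℕ) = 3 ∧ (σ i : ℕ) = 4 := by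
        have h1 : ¬ (k < σ i ∧ σ i < σ k) := fun h => hnc i k hik h.1 h.2
        have h2 : (σ i : ℕ) ≠ σ k := fun h => hik.ne (hσ.injective (Fin.ext h))
        have h3 : (σ i : ℕ) ≠ k := fun h => by
          have h4 : σ i = k := Fin.ext h
          rw [← h4, hσ] at hk
          omega
        have := (σ i).2
        have := (σ k).2
        simp only [Fin.lt_def] at h1 hik
        omega
      obtain ⟨i, k, hi, hk, hik⟩ : ∃ i k : Fin m, (i : ℕ) + 2 ≤ σ i ∧ (k : ℕ) + 2 ≤ σ k ∧
          i < k := by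
        obtain ⟨k, hk, hki⟩ := hlong'
        rcases lt_or_gt_of_ne hki with h | h
        · exact ⟨k, i, hk, hi, h⟩
        · exact ⟨i, k, hi, hk, h⟩
      obtain ⟨rfl, h0, h1, h3, h4⟩ := two i k hi hk hik
      obtain rfl : i = 0 := Fin.ext h0
      obtain rfl : k = 1 := Fin.ext h1
      have s0 : σ 0 = 4 := Fin.ext h4
      have s1 : σ 1 = 3 := Fin.ext h3
      have s4 : σ 4 = 0 := by rw [← s0, hσ]
      have s3 : σ 3 = 1 := by rw [← s1, hσ]
      have s2 : σ 2 = 2 := by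
        have e0 : σ 2 ≠ 4 := fun h => by simpa using hσ.injective (h.trans s0.symm)
        have e1 : σ 2 ≠ 3 := fun h => by simpa using hσ.injective (h.trans s1.symm)
        have e3 : σ 2 ≠ 1 := fun h => by simpa using hσ.injective (h.trans s3.symm)
        have e4 : σ 2 ≠ 0 := fun h => by simpa using hσ.injective (h.trans s4.symm)
        omega
      refine addMonoidAlgebra_of_nested_pair K _ fun f => ?_
      rw [mem_diagSubmonoid]
      constructor
      · intro h
        have e0 := h 0
        have e1 := h 1
        rw [s0] at e0
        rw [s1] at e1
        exact ⟨e0, e1⟩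
      · rintro ⟨e0, e1⟩ i
        fin_cases i
        · change _ = f (σ 0).succ + f (σ 0).castSucc
          rw [s0]; exact e0
        · change _ = f (σ 1).succ + f (σ 1).castSucc
          rw [s1]; exact e1
        · change _ = f (σ 2).succ + f (σ 2).castSucc
          rw [s2]; exact add_comm _ _
        · change f 3 + f 4 = f (σ 3).succ + f (σ 3).castSucc
          rw [s3]; change _ = f 2 + f 1; omega
        · change f 4 + f 5 = f (σ 4).succ + f (σ 4).castSucc
          rw [s4]; change _ = f 1 + f 0; omega
    -- The relation joins only vertices of equal parity, so the two ends of an edge are never in one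
    -- class.
    · have hpar (x y : Fin (m + 1)) (h : Quot.mk r x = Quot.mk r y) :
          (x : ℕ) % 2 = (y : ℕ) % 2 := by
        refine congrArg (Quot.lift (fun x : Fin (m + 1) => (x : ℕ) % 2) ?_) h
        rintro _ _ ⟨k, hk, rfl, rfl⟩
        simp only [Fin.val_castSucc, Fin.val_succ]
        omega
      refine addMonoidAlgebra_of_forall_eq_of_add_eq_add K _ r i.castSucc i.succ (σ i).succ
        (σ i).castSucc (fun h => ?_) (fun h => ?_) fun f => ?_
      · have := hpar _ _ h
        simp only [Fin.val_castSucc, Fin.val_succ] at this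
        omega
      · have := hpar _ _ h
        simp only [Fin.val_castSucc, Fin.val_succ] at this
        omega
      · rw [hmem]
        refine and_congr_right fun _ => ⟨fun h => h i hi, fun h k hk => ?_⟩
        by_cases hki : k = i
        · rw [hki]; exact h
        · exact absurd ⟨k, hk, hki⟩ hlong'
  · refine addMonoidAlgebra_of_forall_eq K _ r fun f => ?_
    rw [hmem]
    exact and_iff_left fun i hi => absurd ⟨i, hi⟩ hlong

end IsCompleteIntersectionAlgebra

/-! ### From matchings to noncrossing involutions and monoid algebras. -/

namespace SymmetricMatching

variable {m : ℕ}

/-- The index linked to `i`. -/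
def partner (D : SymmetricMatching m) (i : Fin m) : Fin m := Sum.elim id id (D.Θ (Sum.inl i))

theorem partner_eq_iff (D : SymmetricMatching m) (i j : Fin m) :
    D.partner i = j ↔ D.Linked i j := by
  unfold partner Linked
  cases D.Θ (Sum.inl i) <;> simp

theorem linked_symm (D : SymmetricMatching m) {i j : Fin m} (h : D.Linked i j) :
    D.Linked j i := by
  rcases h with h | h
  · exact .inl (by rw [← h, D.involutive])
  · exact .inr (by rw [← (D.symm_xy i j).1 h, D.involutive])

theorem partner_involutive (D : SymmetricMatching m) : Function.Involutive D.partner :=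
  fun _ => (D.partner_eq_iff _ _).2 (D.linked_symm ((D.partner_eq_iff _ _).1 rfl))

theorem IsUnmixed.partner_noncrossing {D : SymmetricMatching m} (h : D.IsUnmixed) (i j : Fin m)
    (hij : i < j) (hj : j < D.partner i) (hlt : D.partner i < D.partner j) : False :=
  h ⟨i, j, D.partner i, D.partner j, (D.partner_eq_iff _ _).1 rfl, (D.partner_eq_iff _ _).1 rfl,
    hij, hj, hlt⟩

/-- Exponent vectors, with the roles of the `A`- and `B`-variables exchanged at odd positions. -/
noncomputable def paritySwap (n : ℕ) : (Fin n ⊕ Fin n →₀ ℕ) ≃+ (Fin n → ℕ) × (Fin n → ℕ) where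
  toFun e := (fun k => if Even (k : ℕ) then e (Sum.inl k) else e (Sum.inr k),
    fun k => if Even (k : ℕ) then e (Sum.inr k) else e (Sum.inl k))
  invFun x := Finsupp.equivFunOnFinite.symm <| Sum.elim
    (fun k => if Even (k : ℕ) then x.1 k else x.2 k)
    (fun k => if Even (k : ℕ) then x.2 k else x.1 k)
  left_inv e := by
    ext (k | k) <;> by_cases h : Even (k : ℕ) <;> simp [h]
  right_inv x := by
    ext k <;> by_cases h : Even (k : ℕ) <;> simp [h]
  map_add' e e' := by
    ext k <;> by_cases h : Even (k : ℕ) <;> simp [h]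

/-- After the swap, `p_i + q_{i+1}` is the `A`-sum at `i` for even `i` and the `B`-sum for odd `i`;
`p_{j+1} + q_j` has the two roles reversed. Evenness makes each equation match one of the control
equations of the linked pair, and `i` and its partner together give both. -/
theorem control_iff_paritySwap_mem (D : SymmetricMatching m) (heven : D.IsEven)
    (e : Fin (m + 1) ⊕ Fin (m + 1) →₀ ℕ) :
    D.Control e ↔ paritySwap (m + 1) e ∈ IsCompleteIntersectionAlgebra.pairSubmonoid
      (Fin.castSucc (n := m)) Fin.succ (fun i => (D.partner i).succ)
        (fun i => (D.partner i).castSucc) := by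
  rw [IsCompleteIntersectionAlgebra.mem_pairSubmonoid]
  have hxy (i j : Fin m) (h : D.Θ (Sum.inl i) = Sum.inr j) : Even (i : ℕ) ↔ Even (j : ℕ) := by
    have := (heven i j).1 h
    rw [Int.even_sub] at this
    exact_mod_cast this
  have hxx (i j : Fin m) (h : D.Θ (Sum.inl i) = Sum.inl j) : Even (i : ℕ) ↔ ¬ Even (j : ℕ) := by
    have := (heven i j).2 h
    rw [← Int.not_even_iff_odd, Int.even_sub] at this
    have h' : ¬ (Even (i : ℕ) ↔ Even (j : ℕ)) := by exact_mod_cast this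
    tauto
  constructor
  · intro h i
    rcases hj : D.Θ (Sum.inl i) with j | j
    · have hp : D.partner i = j := (D.partner_eq_iff _ _).2 (.inl hj)
      have h1 := (h i j).2 hj
      have h2 := hxx i j hj
      rw [hp]
      by_cases hi : Even (i : ℕ) <;> by_cases hj' : Even (j : ℕ) <;>
        simp [paritySwap, Nat.even_add_one, hi, hj'] at h2 ⊢ <;> omega
    · have hp : D.partner i = j := (D.partner_eq_iff _ _).2 (.inr hj)
      have h1 := (h i j).1 hj
      have h2 := hxy i j hj
      rw [hp]
      by_cases hi : Even (i : ℕ) <;> by_cases hj' : Even (j : ℕ) <;>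
        simp [paritySwap, Nat.even_add_one, hi, hj'] at h2 ⊢ <;> omega
  · intro h i j
    have h1 := h i
    have h2 := h j
    refine ⟨fun hj => ?_, fun hj => ?_⟩
    · have hp : D.partner i = j := (D.partner_eq_iff _ _).2 (.inr hj)
      have hp' : D.partner j = i := by rw [← hp, D.partner_involutive]
      have h3 := hxy i j hj
      rw [hp] at h1
      rw [hp'] at h2
      by_cases hi : Even (i : ℕ) <;> by_cases hj' : Even (j : ℕ) <;>
        simp [paritySwap, Nat.even_add_one, hi, hj'] at h1 h2 h3 ⊢ <;> omega
    · have hp : D.partner i = j := (D.partner_eq_iff _ _).2 (.inl hj)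
      have hp' : D.partner j = i := by rw [← hp, D.partner_involutive]
      have h3 := hxx i j hj
      rw [hp] at h1
      rw [hp'] at h2
      by_cases hi : Even (i : ℕ) <;> by_cases hj' : Even (j : ℕ) <;>
        simp [paritySwap, Nat.even_add_one, hi, hj'] at h1 h2 h3 ⊢ <;> omega

/-- The monoid of exponent vectors satisfying the control equations. -/
def controlSubmonoid (D : SymmetricMatching m) :
    AddSubmonoid (Fin (m + 1) ⊕ Fin (m + 1) →₀ ℕ) where
  carrier := {e | D.Control e}
  zero_mem' := D.control_zero
  add_mem' := Control.add

/-- The matching ring is the monoid algebra of the exponent vectors satisfying the control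
equations. -/
theorem nonempty_algEquiv_matchingRing (D : SymmetricMatching m) (K : Type*) [Field K] :
    Nonempty (AddMonoidAlgebra K D.controlSubmonoid ≃ₐ[K] D.matchingRing K) := by
  let f : AddMonoidAlgebra K D.controlSubmonoid →ₐ[K]
      MvPolynomial (Fin (m + 1) ⊕ Fin (m + 1)) K :=
    AddMonoidAlgebra.mapDomainAlgHom K K D.controlSubmonoid.subtype
  have hf (x) (c : K) : f (AddMonoidAlgebra.single x c) = MvPolynomial.monomial x.1 c :=
    AddMonoidAlgebra.mapDomain_single
  have hinj : Function.Injective f :=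
    AddMonoidAlgebra.mapDomain_injective Subtype.val_injective
  have hrange : f.range = D.matchingRing K := by
    apply le_antisymm
    · rintro _ ⟨s, rfl⟩
      induction s using AddMonoidAlgebra.induction_linear with
      | zero => exact zero_mem _
      | add s t hs ht =>
        rw [map_add]
        exact add_mem hs ht
      | single x c =>
        intro e he
        have he' : e ∈ (MvPolynomial.monomial x.1 c).support := (hf x c) ▸ he
        rw [Finset.mem_singleton.1 (MvPolynomial.support_monomial_subset he')]
        exact x.2
    · intro p hp
      rw [p.as_sum]
      exact sum_mem fun e he => ⟨AddMonoidAlgebra.single ⟨e, hp e he⟩ _, hf _ _⟩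
  exact ⟨(AlgEquiv.ofInjective f hinj).trans (Subalgebra.equivOfEq _ _ hrange)⟩

end SymmetricMatching

/-- `n = m + 1` is the number of variables `A_i`, so that `Z(n - 1) = Z(m)`. -/
theorem proposition9 (K : Type*) [Field K] (m : ℕ) (hn : m + 1 ≤ 6) (D : SymmetricMatching m)
    (hunmixed : D.IsUnmixed) (heven : D.IsEven) :
    IsCompleteIntersectionAlgebra K (D.matchingRing K) := by
  obtain ⟨e⟩ := D.nonempty_algEquiv_matchingRing K
  refine IsCompleteIntersectionAlgebra.of_algEquiv e ?_
  have hdiag := IsCompleteIntersectionAlgebra.addMonoidAlgebra_diagSubmonoid K (by omega)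
    D.partner_involutive hunmixed.partner_noncrossing
  have hpair := IsCompleteIntersectionAlgebra.addMonoidAlgebra_pairSubmonoid K _ _ _ _ ?_ hdiag
  · let e' : D.controlSubmonoid ≃+ IsCompleteIntersectionAlgebra.pairSubmonoid
        (Fin.castSucc (n := m)) Fin.succ (fun i => (D.partner i).succ)
          (fun i => (D.partner i).castSucc) :=
      { toFun := fun x => ⟨_, (D.control_iff_paritySwap_mem heven x.1).1 x.2⟩
        invFun := fun y => ⟨(SymmetricMatching.paritySwap (m + 1)).symm y.1,
          (D.control_iff_paritySwap_mem heven _).2 (by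
            rw [AddEquiv.apply_symm_apply]
            exact y.2)⟩
        left_inv := fun x => Subtype.ext (AddEquiv.symm_apply_apply _ _)
        right_inv := fun y => Subtype.ext (AddEquiv.apply_symm_apply _ _)
        map_add' := fun x y => Subtype.ext (map_add _ _ _) }
    exact hpair.of_algEquiv (AddMonoidAlgebra.domCongr K K e'.symm)
  · intro x hx
    -- Subtracting the equation at the partner from the one at `i` shows that `p - q` has opposite
    -- increments along linked edges.
    have h (i : Fin m) := eq_of_noncrossing_of_increments_neg D.partner_involutive
      hunmixed.partner_noncrossing (fun k => IsCompleteIntersectionAlgebra.pairSub k x)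
      (fun i => by
        have h1 := hx i
        have h2 := hx (D.partner i)
        simp only [D.partner_involutive i] at h1 h2
        simp only [IsCompleteIntersectionAlgebra.pairSub_apply]
        omega) i
    refine fun i => ⟨h i, ?_⟩
    have := h (D.partner i)
    rw [D.partner_involutive i] at this
    exact this.symm
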